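/- Let $\{(G_n,\tau_n)\}_{n\in\omega}$ be a tower of locally compact Hausdorff groups, i.e. each $G_n$ is a topological subgroup of $G_{n+1}$ (a subgroup whose topology $\tau_n$ is the subspace topology), and let $G=\bigcup_{n} G_n$. Let $\tau_{ind}$ be the finest topology on $G$ making all inclusions $G_n\to G$ continuous, and let $\varinjlim G_n$ denote $G$ with the finest group topology $\tau_{gr}$ making all these inclusions continuous. The Bamboo-Shoot topology $\tau_{BS}$ on $G$ is the topology with open basis $\{g\,\mathrm U[k]\}$, where $g\in G$, $k\in\omega$, $(U_n)_{n\in\omega}$ runs over the sequences in which each $U_n$ is an open symmetric neighborhood of the identity in $G_n$, $\mathrm U^+[k]=\bigcup_{n\ge k}U_kU_{k+1}\cdots U_n$ and $\mathrm U[k]=(\mathrm U^+[k])^{-1}\,\mathrm U^+[k]$. A Hausdorff space is a $k_\omega$-space (respectively, an $\mathcal{MK}_\omega$-space) if it is the union of an increasing sequence of compact (respectively, compact metrizable) subspaces $K_n$ such that a set is open whenever its trace on each $K_n$ is open in $K_n$. Then: (i) $\tau_{ind}=\tau_{BS}$, and this topology is a group topology; (ii) the group $G:=(G,\tau_{ind})=\varinjlim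 G_n$ contains an open subgroup that is a $k_\omega$-space; (iii) if additionally all $G_n$ are metrizable, then: (iii)$_1$ if there is an $m\in\omega$ such that $G_n$ is open in $G_{n+1}$ for every $n\ge m$, then $G$ is metrizable and locally compact; (iii)$_2$ otherwise, $G$ contains an open subgroup that is an $\mathcal{MK}_\omega$-space, and $G$ is sequential but not Fréchet–Urysohn. -/

import Mathlib

open scoped Pointwise Topology

/-- A `k_ω`-space: a Hausdorff space which is the union of an increasing sequence of compact
subsets that determines its topology. -/
structure IsKOmegaSpace (X : Type*) [TopologicalSpace X] : Prop where
  t2 : T2Space X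
  exists_seq : ∃ K : ℕ → Set X, Monotone K ∧ (∀ n, IsCompact (K n)) ∧
    (⋃ n, K n) = Set.univ ∧ Topology.IsCoherentWith (Set.range K)

/-- An `MK_ω`-space: a Hausdorff space which is the union of an increasing sequence of compact
metrizable subspaces that determines its topology. -/
structure IsMKOmegaSpace (X : Type*) [TopologicalSpace X] : Prop where
  t2 : T2Space X
  exists_seq : ∃ K : ℕ → Set X, Monotone K ∧ (∀ n, IsCompact (K n)) ∧
    (∀ n, TopologicalSpace.MetrizableSpace (K n)) ∧
    (⋃ n, K n) = Set.univ ∧ Topology.IsCoherentWith (Set.range K)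

namespace GroupTower

variable {G : Type*} [Group G] (S : ℕ → Subgroup G)

/-- The topology `τ_ind` of the inductive limit in the category of topological spaces: the finest
topology on `G` for which all the inclusions `S n → G` are continuous. A set is open iff its trace
on every `S n` is open. -/
abbrev indTopology [∀ n, TopologicalSpace (S n)] : TopologicalSpace G :=
  ⨆ n, TopologicalSpace.coinduced (Subtype.val : S n → G) inferInstance

/-- The topology `τ_gr` of the inductive limit in the category of topological groups: the finest
group topology on `G` for which all the inclusions `S n → G` are continuous. (In Mathlib's order a
finer topology is smaller.) -/
abbrev grTopology [∀ n, TopologicalSpace (S n)] : TopologicalSpace G :=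
  (sInf {t : GroupTopology G |
    ∀ n, Continuous[inferInstance, t.toTopologicalSpace]
      (Subtype.val : S n → G)}).toTopologicalSpace

/-- A sequence `(U n)`, each `U n` being an open symmetric neighborhood of the identity
in `S n`. -/
structure IsSymmNhdSeq [∀ n, TopologicalSpace (S n)] (U : ∀ n, Set (S n)) : Prop where
  isOpen : ∀ n, IsOpen (U n)
  one_mem : ∀ n, 1 ∈ U n
  symm : ∀ n, (U n)⁻¹ = U n

variable {S}

/-- The product set `U_k U_{k+1} ⋯ U_{k+j}` in `G`. -/
def partialShoot (U : ∀ n, Set (S n)) (k : ℕ) : ℕ → Set G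
  | 0 => Subtype.val '' U k
  | j + 1 => partialShoot U k j * Subtype.val '' U (k + j + 1)

/-- `U⁺[k] = ⋃_{n ≥ k} U_k U_{k+1} ⋯ U_n`. -/
def halfShoot (U : ∀ n, Set (S n)) (k : ℕ) : Set G :=
  ⋃ j, partialShoot U k j

/-- The Bamboo-Shoot neighborhood `U[k] = (U⁺[k])⁻¹ U⁺[k]`. -/
def bambooShoot (U : ∀ n, Set (S n)) (k : ℕ) : Set G :=
  (halfShoot U k)⁻¹ * halfShoot U k

variable (S)

/-- The Bamboo-Shoot topology `τ_BS` on `G`, with the left translates `g U[k]` as open basis. -/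
abbrev bsTopology [∀ n, TopologicalSpace (S n)] : TopologicalSpace G :=
  TopologicalSpace.generateFrom
    {s | ∃ (g : G) (U : ∀ n, Set (S n)) (k : ℕ), IsSymmNhdSeq S U ∧ s = g • bambooShoot U k}

end GroupTower

/-! Local compactness carries the argument. Given an open neighborhood `W` of 1 in the limit
topology, compact sets `c n` in `S n` with `(c⁻¹c)(c⁻¹c) ⊆ W` are built recursively, each thickened
by a symmetric open `V` inside the next group. The thickenings form a sequence `U` with `U[0] U[0] ⊆
W` (`exists_bambooShoot_mul_subset`). This yields both the Bamboo-Shoot basis and continuity of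
multiplication at (1, 1); translations are continuous anyway, so `τ_ind` is a group topology, hence
also `τ_gr`.

The open subgroup is the union of compact symmetric sets `C n` with `C n * C n ⊆ C (n + 1)`, each a
neighborhood of 1 in `S n`; these sets determine its topology. If the tower is eventually open, some
`S m` is open in `G` and passes its local properties on. Otherwise a double sequence escaping the
tower refutes the Fréchet–Urysohn property. -/

namespace GroupTower

open Set Filter

/-! ### Thickening compact sets in locally compact groups -/

section CompactProducts

variable {X : Type*} [Group X] [TopologicalSpace X] [IsTopologicalGroup X]

theorem exists_isOpen_superset_image2 {Y Z : Type*} [TopologicalSpace Y] [TopologicalSpace Z]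
    {f : Y → Y → Z} (hf : Continuous f.uncurry) {D : Set Y} (hD : IsCompact D) {W : Set Z}
    (hW : IsOpen W) (h : ∀ x ∈ D, ∀ y ∈ D, f x y ∈ W) :
    ∃ O, IsOpen O ∧ D ⊆ O ∧ ∀ x ∈ O, ∀ y ∈ O, f x y ∈ W := by
  obtain ⟨u, v, hu, hv, hDu, hDv, huv⟩ := generalized_tube_lemma hD hD (hW.preimage hf)
    (fun p hp => h p.1 hp.1 p.2 hp.2)
  exact ⟨u ∩ v, hu.inter hv, subset_inter hDu hDv,
    fun x hx y hy => huv (mk_mem_prod hx.1 hy.2)⟩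

/-- A compact set `D` with `(D⁻¹D)(D⁻¹D) ⊆ W` can be thickened to a compact set with the same
property. -/
theorem exists_compact_thickening [LocallyCompactSpace X] {D W : Set X} (hD : IsCompact D)
    (hW : IsOpen W) (h : (D⁻¹ * D) * (D⁻¹ * D) ⊆ W) :
    ∃ V c : Set X, IsOpen V ∧ 1 ∈ V ∧ V⁻¹ = V ∧ IsCompact c ∧ D * V ⊆ c ∧
      (c⁻¹ * c) * (c⁻¹ * c) ⊆ W := by
  obtain ⟨O₁, hO₁, hDO₁, hO₁W⟩ := exists_isOpen_superset_image2 (f := fun x y : X => x * y)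
    continuous_mul (hD.inv.mul hD) hW (fun x hx y hy => h (mul_mem_mul hx hy))
  obtain ⟨O₂, hO₂, hDO₂, hO₂W⟩ := exists_isOpen_superset_image2 (f := fun x y : X => x⁻¹ * y)
    (continuous_fst.inv.mul continuous_snd) hD hO₁
    (fun x hx y hy => hDO₁ (mul_mem_mul (inv_mem_inv.2 hx) hy))
  obtain ⟨c, hc, hDc, hcO⟩ := exists_compact_between hD hO₂ hDO₂
  obtain ⟨V, hV, hDV⟩ := compact_open_separated_mul_right hD isOpen_interior hDc
  obtain ⟨V', hV'V, hV'o, hV'1⟩ := mem_nhds_iff.1 hV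
  refine ⟨V' ∩ V'⁻¹, c, hV'o.inter hV'o.inv, ⟨hV'1, by simpa using hV'1⟩, by
    simp [inter_comm], hc, ?_, ?_⟩
  · exact (mul_subset_mul_left (inter_subset_left.trans hV'V)).trans
      (hDV.trans interior_subset)
  · have key : c⁻¹ * c ⊆ O₁ := by
      rintro _ ⟨x, hx, y, hy, rfl⟩
      simpa using hO₂W x⁻¹ (hcO hx) y (hcO hy)
    rintro _ ⟨x, hx, y, hy, rfl⟩
    exact hO₁W x (key hx) y (key hy)

end CompactProducts

variable {G : Type*} [Group G] {S : ℕ → Subgroup G}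

/-! ### Algebra and openness of finite shoots -/

section Shoots

variable {U : ∀ n, Set (S n)}

theorem partialShoot_mono (h1 : ∀ n, 1 ∈ U n) (k : ℕ) : Monotone (partialShoot U k) :=
  monotone_nat_of_le_succ fun _ => subset_mul_left _ ⟨1, h1 _, rfl⟩

theorem one_mem_partialShoot (h1 : ∀ n, 1 ∈ U n) (k j : ℕ) : 1 ∈ partialShoot U k j := by
  induction j with
  | zero => exact ⟨1, h1 k, rfl⟩
  | succ j ih => exact ⟨1, ih, 1, ⟨1, h1 _, rfl⟩, mul_one 1⟩

theorem one_mem_halfShoot (h1 : ∀ n, 1 ∈ U n) (k : ℕ) : 1 ∈ halfShoot U k :=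
  mem_iUnion.2 ⟨0, one_mem_partialShoot h1 k 0⟩

theorem one_mem_bambooShoot (h1 : ∀ n, 1 ∈ U n) (k : ℕ) : 1 ∈ bambooShoot U k :=
  ⟨1, by simpa using one_mem_halfShoot h1 k, 1, one_mem_halfShoot h1 k, mul_one 1⟩

theorem partialShoot_subset (hS : Monotone S) (k j : ℕ) :
    partialShoot U k j ⊆ S (k + j) := by
  induction j with
  | zero => rintro _ ⟨x, -, rfl⟩; exact x.2
  | succ j ih =>
    rintro _ ⟨x, hx, _, ⟨y, -, rfl⟩, rfl⟩
    exact mul_mem (hS (by omega) (ih hx)) y.2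

/-- The last factor is open in the top group, and any set times an open set is open. -/
theorem isOpen_preimage_partialShoot [∀ n, TopologicalSpace (S n)]
    [∀ n, IsTopologicalGroup (S n)] (hS : Monotone S)
    (hU : ∀ n, IsOpen (U n)) (k j : ℕ) :
    IsOpen ((↑) ⁻¹' partialShoot U k j : Set (S (k + j))) := by
  cases j with
  | zero =>
    have : ((↑) ⁻¹' partialShoot U k 0 : Set (S k)) = U k :=
      preimage_image_eq _ Subtype.val_injective
    exact this ▸ hU k
  | succ j =>
    have : ((↑) ⁻¹' partialShoot U k (j + 1) : Set (S (k + j + 1))) =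
        ((↑) ⁻¹' partialShoot U k j : Set (S (k + j + 1))) * U (k + j + 1) := by
      ext x
      constructor
      · rintro ⟨a, ha, _, ⟨b, hb, rfl⟩, hab⟩
        exact ⟨⟨a, hS (by omega) (partialShoot_subset hS k j ha)⟩, ha, b, hb, Subtype.ext hab⟩
      · rintro ⟨a, ha, b, hb, rfl⟩
        exact ⟨a, ha, b, ⟨b, hb, rfl⟩, rfl⟩
    change IsOpen ((↑) ⁻¹' partialShoot U k (j + 1) : Set (S (k + j + 1)))
    rw [this]
    exact (hU _).mul_left

end Shoots

/-! ### The limit topology, its group structure and its descriptions -/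

variable [∀ n, TopologicalSpace (S n)]

/-- `G` carries the inductive limit topology of the tower `S`. -/
structure IsTowerLimit [TopologicalSpace G] (S : ℕ → Subgroup G)
    [∀ n, TopologicalSpace (S n)] : Prop where
  mono : Monotone S
  isEmbedding : ∀ m n (h : m ≤ n), Topology.IsEmbedding (Subgroup.inclusion (mono h))
  exhaust : ∀ g : G, ∃ n, g ∈ S n
  isOpen_iff : ∀ s : Set G, IsOpen s ↔ ∀ n, IsOpen ((↑) ⁻¹' s : Set (S n))

namespace IsTowerLimit

variable [TopologicalSpace G] (hT : IsTowerLimit S)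
include hT

theorem continuous_val (n : ℕ) : Continuous (Subtype.val : S n → G) :=
  continuous_def.2 fun _ hs => (hT.isOpen_iff _).1 hs n

theorem exists_ge (g : G) (m : ℕ) : ∃ n ≥ m, g ∈ S n :=
  let ⟨k, hk⟩ := hT.exhaust g
  ⟨max m k, le_max_left _ _, hT.mono (le_max_right _ _) hk⟩

/-- Traces on arbitrarily large members of the tower decide openness. -/
theorem isOpen_of_forall_exists_ge {s : Set G}
    (h : ∀ n, ∃ m ≥ n, IsOpen ((↑) ⁻¹' s : Set (S m))) : IsOpen s := by
  refine (hT.isOpen_iff s).2 fun n => ?_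
  obtain ⟨m, hm, ho⟩ := h n
  exact ho.preimage (hT.isEmbedding n m hm).continuous

theorem continuous_of_forall_exists_ge {Y : Type*} [TopologicalSpace Y] {f : G → Y}
    (h : ∀ n, ∃ m ≥ n, Continuous (fun x : S m => f x)) : Continuous f :=
  continuous_def.2 fun _ hs => hT.isOpen_of_forall_exists_ge fun n =>
    let ⟨m, hm, hc⟩ := h n
    ⟨m, hm, hs.preimage hc⟩

theorem isClosed_iff (s : Set G) : IsClosed s ↔ ∀ n, IsClosed ((↑) ⁻¹' s : Set (S n)) := by
  simp only [← isOpen_compl_iff, hT.isOpen_iff, preimage_compl]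

theorem t1Space [∀ n, T2Space (S n)] : T1Space G :=
  ⟨fun _ => (hT.isClosed_iff _).2 fun _ =>
    (Set.Subsingleton.finite fun _ ha _ hb => Subtype.ext (ha.trans hb.symm)).isClosed⟩

variable [∀ n, IsTopologicalGroup (S n)]

theorem continuous_mul_left (g : G) : Continuous (g * ·) :=
  hT.continuous_of_forall_exists_ge fun n =>
    let ⟨m, hm, hg⟩ := hT.exists_ge g n
    ⟨m, hm, (hT.continuous_val m).comp (continuous_const_mul (⟨g, hg⟩ : S m))⟩

theorem continuous_mul_right (g : G) : Continuous (· * g) :=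
  hT.continuous_of_forall_exists_ge fun n =>
    let ⟨m, hm, hg⟩ := hT.exists_ge g n
    ⟨m, hm, (hT.continuous_val m).comp (continuous_mul_const (⟨g, hg⟩ : S m))⟩

theorem continuous_inv : Continuous (fun x : G => x⁻¹) :=
  hT.continuous_of_forall_exists_ge fun n =>
    ⟨n, le_rfl, (hT.continuous_val n).comp (ContinuousInv.continuous_inv (G := S n))⟩

/-- Finite shoots increase with length, so on `S (k + n)` the union may start at `j = n`; those
shoots are open in larger groups, and their traces are pulled back along inclusions. -/
theorem isOpen_halfShoot {U : ∀ n, Set (S n)} (hU : IsSymmNhdSeq S U) (k : ℕ) :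
    IsOpen (halfShoot U k) := by
  refine hT.isOpen_of_forall_exists_ge fun n => ⟨k + n, by omega, ?_⟩
  have : ((↑) ⁻¹' halfShoot U k : Set (S (k + n))) =
      ⋃ j, ⋃ h : n ≤ j, Subgroup.inclusion (hT.mono (Nat.add_le_add_left h k)) ⁻¹'
        ((↑) ⁻¹' partialShoot U k j) := by
    ext x
    simp only [halfShoot, mem_preimage, mem_iUnion, Subgroup.coe_inclusion, exists_prop]
    constructor
    · rintro ⟨j, hj⟩
      exact ⟨max n j, le_max_left _ _, partialShoot_mono hU.one_mem k (le_max_right _ _) hj⟩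
    · rintro ⟨j, -, hj⟩
      exact ⟨j, hj⟩
  rw [this]
  exact isOpen_iUnion fun j => isOpen_iUnion fun h =>
    (isOpen_preimage_partialShoot hT.mono hU.isOpen k j).preimage
      (hT.isEmbedding _ _ (Nat.add_le_add_left h k)).continuous

theorem separatelyContinuousMul : SeparatelyContinuousMul G where
  continuous_const_mul {g} := hT.continuous_mul_left g
  continuous_mul_const {g} := hT.continuous_mul_right g

theorem isOpen_bambooShoot {U : ∀ n, Set (S n)} (hU : IsSymmNhdSeq S U) (k : ℕ) :
    IsOpen (bambooShoot U k) :=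
  have := hT.separatelyContinuousMul
  (hT.isOpen_halfShoot hU k).mul_left

/-- Local compactness of the tower: Bamboo-Shoot neighbourhoods are small. -/
theorem exists_bambooShoot_mul_subset [∀ n, LocallyCompactSpace (S n)] {W : Set G}
    (hW : IsOpen W) (h1 : 1 ∈ W) :
    ∃ U : ∀ n, Set (S n), IsSymmNhdSeq S U ∧ bambooShoot U 0 * bambooShoot U 0 ⊆ W := by
  have hWn (n : ℕ) := (hT.isOpen_iff W).1 hW n
  let good (n : ℕ) (c : Set (S n)) : Prop :=
    IsCompact c ∧ (c⁻¹ * c) * (c⁻¹ * c) ⊆ ((↑) ⁻¹' W : Set (S n))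
  have step (n : ℕ) (c : {c // good n c}) : ∃ (V : Set (S (n + 1))) (c' : {c // good (n + 1) c}),
      IsOpen V ∧ 1 ∈ V ∧ V⁻¹ = V ∧
        (Subtype.val '' c.1 : Set G) * Subtype.val '' V ⊆ Subtype.val '' c'.1 := by
    obtain ⟨c, hc, hcW⟩ := c
    let i := Subgroup.inclusion (hT.mono n.le_succ)
    have hi : Continuous i := (hT.isEmbedding _ _ n.le_succ).continuous
    obtain ⟨V, c', hV, hV1, hVs, hc', hcV, hc'W⟩ := exists_compact_thickening (D := i '' c)
      (hc.image hi) (hWn (n + 1)) (by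
        rw [← image_inv, ← image_mul, ← image_mul]
        rintro _ ⟨x, hx, rfl⟩
        exact hcW hx)
    refine ⟨V, ⟨c', hc', hc'W⟩, hV, hV1, hVs, ?_⟩
    rintro _ ⟨_, ⟨x, hx, rfl⟩, _, ⟨y, hy, rfl⟩, rfl⟩
    exact ⟨i x * y, hcV (mul_mem_mul (mem_image_of_mem i hx) hy), rfl⟩
  choose V c hV hV1 hVs hcV using step
  -- Thickening the trivial compact set `{1}` starts the recursion.
  obtain ⟨V₀, c₀, hV₀, hV₀1, hV₀s, hc₀, hcV₀, hc₀W⟩ := exists_compact_thickening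
    (D := {1}) isCompact_singleton (hWn 0) (by simpa using h1)
  let f : ∀ n, {c // good n c} := Nat.rec ⟨c₀, hc₀, hc₀W⟩ c
  let U : ∀ n, Set (S n) := Nat.rec V₀ fun n _ => V n (f n)
  have hf (j : ℕ) : partialShoot U 0 j ⊆ Subtype.val '' (f j).1 := by
    induction j with
    | zero => exact image_mono (f := Subtype.val) (by simpa using hcV₀ : V₀ ⊆ c₀)
    | succ j ih =>
      have : partialShoot U 0 (j + 1) = partialShoot U 0 j * Subtype.val '' U (j + 1) := by
        rw [partialShoot, Nat.zero_add]
      rw [this]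
      exact (mul_subset_mul_right ih).trans (hcV j (f j))
  refine ⟨U, ⟨?_, ?_, ?_⟩, ?_⟩
  · rintro (_ | n)
    exacts [hV₀, hV _ _]
  · rintro (_ | n)
    exacts [hV₀1, hV1 _ _]
  · rintro (_ | n)
    exacts [hV₀s, hVs _ _]
  · have hmono : Monotone (partialShoot U 0) := partialShoot_mono (by
      rintro (_ | n)
      exacts [hV₀1, hV1 _ _]) 0
    rintro _ ⟨_, ⟨a, ha, b, hb, rfl⟩, _, ⟨p, hp, q, hq, rfl⟩, rfl⟩
    obtain ⟨ja, ha⟩ := mem_iUnion.1 (show a⁻¹ ∈ halfShoot U 0 from ha)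
    obtain ⟨jb, hb⟩ := mem_iUnion.1 hb
    obtain ⟨jp, hp⟩ := mem_iUnion.1 (show p⁻¹ ∈ halfShoot U 0 from hp)
    obtain ⟨jq, hq⟩ := mem_iUnion.1 hq
    -- All four factors lie in one compact set `f j`, whose fourfold product is controlled by `W`.
    let j := max (max ja jb) (max jp jq)
    obtain ⟨a', ha', hae⟩ := hf j (hmono (show ja ≤ j by omega) ha)
    obtain ⟨b', hb', rfl⟩ := hf j (hmono (show jb ≤ j by omega) hb)
    obtain ⟨p', hp', hpe⟩ := hf j (hmono (show jp ≤ j by omega) hp)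
    obtain ⟨q', hq', rfl⟩ := hf j (hmono (show jq ≤ j by omega) hq)
    have := (f j).2.2 (mul_mem_mul (mul_mem_mul (inv_mem_inv.2 ha') hb')
      (mul_mem_mul (inv_mem_inv.2 hp') hq'))
    simpa [hae, hpe] using this

theorem isTopologicalGroup [∀ n, LocallyCompactSpace (S n)] : IsTopologicalGroup G := by
  have := hT.separatelyContinuousMul
  have hmul : ContinuousMul G := by
    refine ContinuousMul.of_nhds_one ?_ (fun g => ?_) (fun g => ?_)
    · rw [tendsto_def]
      intro W hW
      obtain ⟨W', hW'W, hW', h1⟩ := mem_nhds_iff.1 hW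
      obtain ⟨U, hU, hUW⟩ := hT.exists_bambooShoot_mul_subset hW' h1
      have hB := (hT.isOpen_bambooShoot hU 0).mem_nhds (one_mem_bambooShoot hU.one_mem 0)
      filter_upwards [prod_mem_prod hB hB] with p hp
      exact hW'W (hUW (mul_mem_mul hp.1 hp.2))
    · simpa using ((Homeomorph.mulLeft g).map_nhds_eq 1).symm
    · simpa using ((Homeomorph.mulRight g).map_nhds_eq 1).symm
  exact { hmul with continuous_inv := hT.continuous_inv }

theorem t2Space [∀ n, T2Space (S n)] [∀ n, LocallyCompactSpace (S n)] : T2Space G := by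
  have := hT.t1Space
  have := hT.isTopologicalGroup
  infer_instance

theorem eq_bsTopology [∀ n, LocallyCompactSpace (S n)] :
    ‹TopologicalSpace G› = bsTopology S := by
  have := hT.isTopologicalGroup
  refine le_antisymm (le_generateFrom ?_) fun s hs => ?_
  · rintro _ ⟨g, U, k, hU, rfl⟩
    exact (hT.isOpen_bambooShoot hU k).smul g
  · refine (@isOpen_iff_forall_mem_open G (bsTopology S) s).2 fun g hg => ?_
    obtain ⟨U, hU, hUs⟩ := hT.exists_bambooShoot_mul_subset (hs.smul g⁻¹)
      (W := g⁻¹ • s) ⟨g, hg, by simp⟩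
    refine ⟨g • bambooShoot U 0, ?_, .basic _ ⟨g, U, 0, hU, rfl⟩,
      ⟨1, one_mem_bambooShoot hU.one_mem 0, by simp⟩⟩
    rintro _ ⟨x, hx, rfl⟩
    exact mem_inv_smul_set_iff.1
      (hUs ⟨1, one_mem_bambooShoot hU.one_mem 0, x, hx, one_mul x⟩)

theorem eq_grTopology [∀ n, LocallyCompactSpace (S n)] :
    ‹TopologicalSpace G› = grTopology S := by
  have := hT.isTopologicalGroup
  let t : GroupTopology G := ⟨‹_›, hT.isTopologicalGroup⟩
  have : IsLeast {t : GroupTopology G | ∀ n, Continuous[inferInstance, t.toTopologicalSpace]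
      (Subtype.val : S n → G)} t := by
    refine ⟨hT.continuous_val, fun t' ht' s hs => (hT.isOpen_iff s).2 fun n => ?_⟩
    exact (continuous_def.1 (ht' n)) s hs
  exact congrArg GroupTopology.toTopologicalSpace this.isGLB.sInf_eq.symm

end IsTowerLimit

/-! ### The open `k_ω`-subgroup -/

section Exhaustion

/-- A sequence of compact symmetric neighbourhoods of the identity `C n` in `S n` satisfying
`C n * C n ⊆ C (n + 1)`. -/
structure IsExhaustion (S : ℕ → Subgroup G) [∀ n, TopologicalSpace (S n)] (C : ℕ → Set G) :
    Prop where
  exists_isCompact : ∀ n, ∃ c : Set (S n), IsCompact c ∧ Subtype.val '' c = C n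
  symm : ∀ n, (C n)⁻¹ = C n
  mul_subset : ∀ n, C n * C n ⊆ C (n + 1)
  preimage_mem_nhds : ∀ n, ((↑) ⁻¹' C n : Set (S n)) ∈ 𝓝 1

namespace IsExhaustion

variable {C : ℕ → Set G} (hC : IsExhaustion S C)
include hC

theorem one_mem (n : ℕ) : 1 ∈ C n :=
  have := mem_of_mem_nhds (hC.preimage_mem_nhds n)
  this

theorem monotone : Monotone C :=
  monotone_nat_of_le_succ fun n => (subset_mul_left _ (hC.one_mem n)).trans (hC.mul_subset n)

/-- The subgroup exhausted by the sets `C n`. -/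
def subgroup : Subgroup G where
  carrier := ⋃ n, C n
  one_mem' := mem_iUnion.2 ⟨0, hC.one_mem 0⟩
  mul_mem' {a b} ha hb := by
    obtain ⟨i, hi⟩ := mem_iUnion.1 ha
    obtain ⟨j, hj⟩ := mem_iUnion.1 hb
    exact mem_iUnion.2 ⟨max i j + 1, hC.mul_subset _ (mul_mem_mul
      (hC.monotone (le_max_left _ _) hi) (hC.monotone (le_max_right _ _) hj))⟩
  inv_mem' {a} ha := by
    obtain ⟨i, hi⟩ := mem_iUnion.1 ha
    exact mem_iUnion.2 ⟨i, by rw [← hC.symm i]; simpa using hi⟩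

/-- The members of the exhaustion, as subsets of the subgroup they exhaust. -/
def trace (n : ℕ) : Set hC.subgroup := (↑) ⁻¹' C n

theorem image_trace (n : ℕ) : Subtype.val '' hC.trace n = C n := by
  refine (image_preimage_eq_inter_range).trans (inter_eq_left.2 fun x hx => ?_)
  exact ⟨⟨x, mem_iUnion.2 ⟨n, hx⟩⟩, rfl⟩

theorem iUnion_trace : ⋃ n, hC.trace n = univ := by
  ext x
  simpa [trace] using mem_iUnion.1 x.2

theorem monotone_trace : Monotone hC.trace := fun _ _ h => preimage_mono (hC.monotone h)

variable [TopologicalSpace G] (hT : IsTowerLimit S)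
include hT

/-- A point `x` of `A` in `S m` lies in some `C j`, so the `S m`-neighborhood `x (C m ∩ S m)` of `x`
stays in `C (max j m + 1)`, where `A` agrees with an open set. -/
theorem isOpen_of_forall_trace [∀ n, IsTopologicalGroup (S n)] {A : Set G} (hA : A ⊆ ⋃ n, C n)
    (h : ∀ n, ∃ O, IsOpen O ∧ A ∩ C n = O ∩ C n) : IsOpen A := by
  refine (hT.isOpen_iff A).2 fun m => isOpen_iff_mem_nhds.2 fun x hx => ?_
  obtain ⟨j, hj⟩ := mem_iUnion.1 (hA hx)
  obtain ⟨O, hO, hOA⟩ := h (max j m + 1)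
  have hmul {y : G} (hy : (x : G)⁻¹ * y ∈ C m) : y ∈ C (max j m + 1) := by
    simpa using hC.mul_subset _ (mul_mem_mul (hC.monotone (le_max_left j m) hj)
      (hC.monotone (le_max_right j m) hy))
  have hxO : (x : G) ∈ O :=
    (hOA.subset ⟨hx, hC.monotone (by omega) hj⟩).1
  have hlim : Tendsto (fun y : S m => x⁻¹ * y) (𝓝 x) (𝓝 1) := by
    simpa using (continuous_const_mul x⁻¹).tendsto x
  filter_upwards [hlim (hC.preimage_mem_nhds m),
    (hO.preimage (hT.continuous_val m)).mem_nhds hxO] with y hy hyO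
  exact (hOA.superset ⟨hyO, hmul hy⟩).1

theorem isOpen_subgroup [∀ n, IsTopologicalGroup (S n)] : IsOpen (hC.subgroup : Set G) :=
  hC.isOpen_of_forall_trace hT subset_rfl fun n =>
    ⟨univ, isOpen_univ, by
      rw [univ_inter]; exact inter_eq_right.2 (subset_iUnion C n)⟩

theorem isCompact_trace (n : ℕ) : IsCompact (hC.trace n) := by
  rw [Subtype.isCompact_iff, hC.image_trace]
  obtain ⟨c, hc, hcC⟩ := hC.exists_isCompact n
  exact hcC ▸ hc.image (hT.continuous_val n)

theorem isCoherentWith_trace [∀ n, IsTopologicalGroup (S n)] :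
    Topology.IsCoherentWith (range hC.trace) := by
  refine ⟨fun s hs => ?_⟩
  have : IsOpen (Subtype.val '' s : Set G) := by
    refine hC.isOpen_of_forall_trace hT ?_ fun n => ?_
    · rintro _ ⟨x, -, rfl⟩
      exact x.2
    · obtain ⟨t, ht, hts⟩ := isOpen_induced_iff.1 (hs _ (mem_range_self n))
      obtain ⟨O, hO, rfl⟩ := isOpen_induced_iff.1 ht
      refine ⟨O, hO, ?_⟩
      have key (x : hC.subgroup) (hx : (x : G) ∈ C n) : (x : G) ∈ O ↔ x ∈ s :=
        Set.ext_iff.1 hts ⟨x, hx⟩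
      ext x
      constructor
      · rintro ⟨⟨y, hy, rfl⟩, hx⟩
        exact ⟨(key y hx).2 hy, hx⟩
      · rintro ⟨hxO, hx⟩
        exact ⟨⟨⟨x, mem_iUnion.2 ⟨n, hx⟩⟩, (key _ hx).1 hxO, rfl⟩, hx⟩
  rw [← preimage_image_eq s Subtype.val_injective]
  exact this.preimage continuous_subtype_val

theorem isKOmegaSpace_subgroup [T2Space G] [∀ n, IsTopologicalGroup (S n)] :
    IsKOmegaSpace hC.subgroup where
  t2 := inferInstance
  exists_seq := ⟨hC.trace, hC.monotone_trace, hC.isCompact_trace hT, hC.iUnion_trace,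
    hC.isCoherentWith_trace hT⟩

/-- A continuous bijection from a compact subset of the metrizable `S n` onto a Hausdorff space is a
homeomorphism. -/
theorem metrizableSpace_trace [T2Space G] [∀ n, TopologicalSpace.MetrizableSpace (S n)] (n : ℕ) :
    TopologicalSpace.MetrizableSpace (hC.trace n) := by
  obtain ⟨c, hc, hcC⟩ := hC.exists_isCompact n
  have hmem (x : c) : ((x : S n) : G) ∈ C n := hcC ▸ mem_image_of_mem _ x.2
  let f (x : c) : hC.trace n := ⟨⟨x, mem_iUnion.2 ⟨n, hmem x⟩⟩, hmem x⟩
  have hf : Continuous f := (((hT.continuous_val n).comp continuous_subtype_val).subtype_mk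
    _).subtype_mk _
  have hbij : Function.Bijective f := by
    constructor
    · intro x y hxy
      have : ((f x : hC.subgroup) : G) = (f y : hC.subgroup) := by rw [hxy]
      exact Subtype.ext (Subtype.ext this)
    · rintro ⟨⟨x, hx'⟩, hx⟩
      obtain ⟨y, hy, rfl⟩ := hcC.superset hx
      exact ⟨⟨y, hy⟩, rfl⟩
  have := isCompact_iff_compactSpace.1 hc
  exact (Continuous.homeoOfEquivCompactToT2 (f := Equiv.ofBijective f hbij)
    hf).symm.isEmbedding.metrizableSpace

theorem isMKOmegaSpace_subgroup [T2Space G] [∀ n, IsTopologicalGroup (S n)]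
    [∀ n, TopologicalSpace.MetrizableSpace (S n)] :
    IsMKOmegaSpace hC.subgroup where
  t2 := inferInstance
  exists_seq := ⟨hC.trace, hC.monotone_trace, hC.isCompact_trace hT,
    hC.metrizableSpace_trace hT, hC.iUnion_trace, hC.isCoherentWith_trace hT⟩

end IsExhaustion

theorem IsTowerLimit.exists_isExhaustion [TopologicalSpace G] (hT : IsTowerLimit S)
    [∀ n, IsTopologicalGroup (S n)] [∀ n, LocallyCompactSpace (S n)] :
    ∃ C : ℕ → Set G, IsExhaustion S C := by
  have (n : ℕ) : ∃ K : Set (S n), IsCompact K ∧ K⁻¹ = K ∧ K ∈ 𝓝 1 := by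
    obtain ⟨K, hK, hK1⟩ := exists_compact_mem_nhds (1 : S n)
    exact ⟨K ∪ K⁻¹, hK.union hK.inv, by simp [union_comm], mem_of_superset hK1 subset_union_left⟩
  choose K hK hKs hK1 using this
  let E (n : ℕ) : Set G := Subtype.val '' K n
  let C : ℕ → Set G := Nat.rec (E 0) fun n D => (D ∪ E (n + 1)) * (D ∪ E (n + 1))
  have hEs (n : ℕ) : (E n)⁻¹ = E n := by
    ext x
    constructor
    · rintro ⟨y, hy, hxy⟩
      exact ⟨y⁻¹, hKs n ▸ inv_mem_inv.2 hy, by simp [hxy]⟩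
    · rintro ⟨y, hy, rfl⟩
      exact ⟨y⁻¹, hKs n ▸ inv_mem_inv.2 hy, by simp⟩
  have hE1 (n : ℕ) : 1 ∈ E n := ⟨1, mem_of_mem_nhds (hK1 n), rfl⟩
  have hEC (n : ℕ) : E n ⊆ C n := by
    cases n with
    | zero => exact subset_rfl
    | succ n => exact subset_union_right.trans (subset_mul_left _ (Or.inr (hE1 _)))
  refine ⟨C, fun n => ?_, fun n => ?_, fun n => mul_subset_mul subset_union_left subset_union_left,
    fun n => mem_of_superset (hK1 n) fun x hx => hEC n (mem_image_of_mem _ hx)⟩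
  · induction n with
    | zero => exact ⟨K 0, hK 0, rfl⟩
    | succ n ih =>
      obtain ⟨c, hc, hcC⟩ := ih
      have hi : Continuous (Subgroup.inclusion (hT.mono n.le_succ)) :=
        (hT.isEmbedding _ _ n.le_succ).continuous
      have hD := (hc.image hi).union (hK (n + 1))
      refine ⟨_, hD.mul hD, ?_⟩
      have himg : Subtype.val '' (Subgroup.inclusion (hT.mono n.le_succ) '' c ∪ K (n + 1)) =
          C n ∪ E (n + 1) := by
        rw [image_union, image_image, ← hcC]
        rfl
      change (S (n + 1)).subtype '' _ = _
      rw [image_mul]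
      exact congrArg₂ (· * ·) himg himg
  · induction n with
    | zero => exact hEs 0
    | succ n ih =>
      change ((C n ∪ E (n + 1)) * (C n ∪ E (n + 1)))⁻¹ = (C n ∪ E (n + 1)) * (C n ∪ E (n + 1))
      rw [mul_inv_rev, union_inv, ih, hEs]

end Exhaustion

namespace IsTowerLimit

variable [TopologicalSpace G] (hT : IsTowerLimit S)

/-! ### Eventually open towers -/

section EventuallyOpen

variable {m : ℕ} (hm : ∀ n ≥ m, IsOpen ((S n).subgroupOf (S (n + 1)) : Set (S (n + 1))))
include hT hm

theorem isOpenMap_inclusion_of_isOpen (n : ℕ) (h : m ≤ n) :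
    IsOpenMap (Subgroup.inclusion (hT.mono h)) := by
  induction n, h using Nat.le_induction with
  | base => exact fun s hs => by convert hs; ext; simp [Subgroup.inclusion]
  | succ n h ih =>
    have ho : Topology.IsOpenEmbedding (Subgroup.inclusion (hT.mono n.le_succ)) :=
      ⟨hT.isEmbedding _ _ n.le_succ, by
        rw [← MonoidHom.coe_range, Subgroup.inclusion_range]; exact hm n h⟩
    exact ho.isOpenMap.comp ih

theorem isOpenEmbedding_val_of_isOpen :
    Topology.IsOpenEmbedding (Subtype.val : S m → G) := by
  refine .of_continuous_injective_isOpenMap (hT.continuous_val m) Subtype.val_injective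
    fun V hV => hT.isOpen_of_forall_exists_ge fun n => ⟨max m n, le_max_right _ _, ?_⟩
  convert hT.isOpenMap_inclusion_of_isOpen hm _ (le_max_left m n) V hV
  ext x
  simp [Subtype.ext_iff]

theorem locallyCompactSpace_of_isOpen [∀ n, IsTopologicalGroup (S n)]
    [∀ n, LocallyCompactSpace (S n)] :
    LocallyCompactSpace G := by
  have := hT.isTopologicalGroup
  have he := hT.isOpenEmbedding_val_of_isOpen hm
  obtain ⟨K, hK, hK1⟩ := exists_compact_mem_nhds (1 : S m)
  exact (hK.image he.continuous).locallyCompactSpace_of_mem_nhds_of_group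
    (he.isOpenMap.image_mem_nhds hK1)

theorem metrizableSpace_of_isOpen [∀ n, IsTopologicalGroup (S n)] [∀ n, LocallyCompactSpace (S n)]
    [∀ n, TopologicalSpace.MetrizableSpace (S n)] : TopologicalSpace.MetrizableSpace G := by
  have := hT.isTopologicalGroup
  have := hT.t2Space
  have hcount : (𝓝 (1 : G)).IsCountablyGenerated := by
    have := (hT.isOpenEmbedding_val_of_isOpen hm).map_nhds_eq 1
    rw [OneMemClass.coe_one] at this
    exact this ▸ inferInstance
  -- Birkhoff–Kakutani: a first countable Hausdorff group has a countably generated uniformity.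
  let _ := IsTopologicalGroup.rightUniformSpace G
  have : (uniformity G).IsCountablyGenerated := comap.isCountablyGenerated _ _
  exact UniformSpace.metrizableSpace

end EventuallyOpen

/-! ### Sequentiality and failure of the Fréchet–Urysohn property -/

section NotFrechetUrysohn

include hT

/-- A subgroup that is not open is a neighborhood of none of its points. -/
theorem mem_closure_inter_of_not_isOpen [∀ n, IsTopologicalGroup (S n)] {n : ℕ}
    (hn : ¬ IsOpen ((S n).subgroupOf (S (n + 1)) : Set (S (n + 1)))) {x : G} (hx : x ∈ S n)
    {W : Set G} (hW : W ∈ 𝓝 x) : x ∈ closure (W ∩ (S (n + 1) \ S n : Set G)) := by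
  refine mem_closure_iff_nhds.2 fun O hO => ?_
  by_contra hne
  refine hn (Subgroup.isOpen_of_mem_nhds _ (g := ⟨x, hT.mono n.le_succ hx⟩) ?_)
  filter_upwards [(hT.continuous_val (n + 1)).continuousAt (inter_mem hO hW)] with y hy
  by_contra hyn
  exact hne ⟨y, hy.1, hy.2, y.2, hyn⟩

theorem sequentialSpace [∀ n, TopologicalSpace.MetrizableSpace (S n)] : SequentialSpace G := by
  refine ⟨fun s hs => (hT.isClosed_iff s).2 fun n => IsSeqClosed.isClosed fun u x hu hux => ?_⟩
  exact hs hu (((hT.continuous_val n).tendsto x).comp hux)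

/-- A sequence which meets every member of the tower finitely often converges only to its own
values. -/
theorem mem_range_of_tendsto [∀ n, T2Space (S n)] {u : ℕ → G} {x : G}
    (hu : Tendsto u atTop (𝓝 x)) (hfin : ∀ n, {j | u j ∈ S n}.Finite) : x ∈ range u := by
  have : IsClosed (range u) := (hT.isClosed_iff _).2 fun n => by
    refine Set.Finite.isClosed (Set.Finite.of_finite_image (f := Subtype.val)
      (((hfin n).image u).subset ?_) Subtype.val_injective.injOn)
    rintro _ ⟨y, ⟨j, hj⟩, rfl⟩
    exact ⟨j, show u j ∈ S n from hj ▸ y.2, hj⟩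
  exact this.mem_of_tendsto hu (Eventually.of_forall mem_range_self)

/-- Points `x k → 1` are approximated from `S (ν k + 1) \ S (ν k)`, which puts 1 in the closure of
the resulting set `A`. A sequence in `A` tending to 1 meets each `S n` finitely often, so 1 would be
one of its values, yet `1 ∉ A`. -/
theorem not_frechetUrysohnSpace [∀ n, IsTopologicalGroup (S n)] [∀ n, LocallyCompactSpace (S n)]
    [∀ n, TopologicalSpace.MetrizableSpace (S n)]
    (h : ¬ ∃ m, ∀ n ≥ m, IsOpen ((S n).subgroupOf (S (n + 1)) : Set (S (n + 1)))) :
    ¬ FrechetUrysohnSpace G := by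
  intro hFU
  have := hT.isTopologicalGroup
  have := hT.t2Space
  push Not at h
  obtain ⟨n₀, -, hn₀⟩ := h 0
  -- `S p` is not discrete, since its subgroup `S n₀` is not open.
  obtain ⟨p, hp⟩ : ∃ p, p = n₀ + 1 := ⟨_, rfl⟩
  -- The bound `p` puts `x k` in `S (ν k)`; the bound `k` lets only the pieces with `k < n` meet `S
  -- n`.
  choose ν hν hbad using fun k => h (max p k)
  have hnd : (1 : S p) ∈ closure {1}ᶜ := by
    subst hp
    rw [closure_compl, mem_compl_iff, mem_interior_iff_mem_nhds]
    intro h1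
    refine hn₀ (Subgroup.isOpen_of_mem_nhds _ (g := 1) (mem_of_superset h1 ?_))
    exact singleton_subset_iff.2 (one_mem _)
  obtain ⟨x, hx1, hx⟩ := mem_closure_iff_seq_limit.1 hnd
  have hx1' (k : ℕ) : (x k : G) ≠ 1 := fun h => hx1 k (Subtype.ext h)
  have hxν (k : ℕ) : (x k : G) ∈ S (ν k) :=
    hT.mono ((le_max_left _ _).trans (hν k)) (x k).2
  -- By regularity; finite unions of these closed sets still miss a neighborhood of 1.
  have (k : ℕ) : ∃ W ∈ 𝓝 (x k : G), IsClosed W ∧ W ⊆ {1}ᶜ :=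
    exists_mem_nhds_isClosed_subset (isOpen_compl_singleton.mem_nhds (hx1' k))
  choose W hW hWc hW1 using this
  let A : Set G := ⋃ k, W k ∩ (S (ν k + 1) \ S (ν k) : Set G)
  have hA : (1 : G) ∈ closure A := by
    refine isClosed_closure.mem_of_tendsto (b := atTop) (f := fun k => (x k : G))
      (((hT.continuous_val p).tendsto 1).comp hx) (Eventually.of_forall fun k => ?_)
    exact closure_mono (subset_iUnion _ k)
      (hT.mem_closure_inter_of_not_isOpen (hbad k) (hxν k) (hW k))
  obtain ⟨u, huA, hu⟩ := mem_closure_iff_seq_limit.1 hA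
  have hAW (n : ℕ) : A ∩ S n ⊆ ⋃ k ∈ Iio n, W k := by
    rintro y ⟨hyA, hyn⟩
    obtain ⟨k, hyW, -, hyk⟩ := mem_iUnion.1 hyA
    have hkn : k < n := by
      by_contra! hnk
      exact hyk (hT.mono (hnk.trans ((le_max_right _ _).trans (hν k))) hyn)
    exact mem_biUnion (mem_Iio.2 hkn) hyW
  obtain ⟨j, hj⟩ := hT.mem_range_of_tendsto hu fun n => by
    have hc : IsClosed (⋃ k ∈ Iio n, W k) := (finite_Iio n).isClosed_biUnion fun k _ => hWc k
    have h1 : (1 : G) ∈ (⋃ k ∈ Iio n, W k)ᶜ := by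
      simp only [mem_compl_iff, mem_iUnion, not_exists]
      exact fun k _ hk => hW1 k hk rfl
    have hev := hu (hc.isOpen_compl.mem_nhds h1)
    rw [mem_map, ← Nat.cofinite_eq_atTop] at hev
    exact Set.Finite.subset hev fun j hj hju => hju (hAW n ⟨huA j, hj⟩)
  obtain ⟨k, hk, -⟩ := mem_iUnion.1 (huA j)
  exact hW1 k hk hj

end NotFrechetUrysohn

end IsTowerLimit

theorem isTowerLimit_indTopology (hle : ∀ n, S n ≤ S (n + 1))
    (hemb : ∀ n, Topology.IsEmbedding (Subgroup.inclusion (hle n)))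
    (hunion : ∀ g : G, ∃ n, g ∈ S n) :
    @IsTowerLimit G _ (indTopology S) S _ :=
  let _ := indTopology S
  { mono := monotone_nat_of_le_succ hle
    isEmbedding := fun m n h => by
      induction n, h using Nat.le_induction with
      | base => exact Topology.IsEmbedding.id
      | succ n h ih => exact (hemb n).comp ih
    exhaust := hunion
    isOpen_iff := fun s => by
      rw [isOpen_iSup_iff]
      rfl }

end GroupTower

theorem propositionp {G : Type*} [Group G] (S : ℕ → Subgroup G)
    [∀ n, TopologicalSpace (S n)] [∀ n, IsTopologicalGroup (S n)]
    [∀ n, T2Space (S n)] [∀ n, LocallyCompactSpace (S n)]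
    (hle : ∀ n, S n ≤ S (n + 1))
    (hemb : ∀ n, Topology.IsEmbedding (Subgroup.inclusion (hle n)))
    (hunion : ∀ g : G, ∃ n, g ∈ S n) :
    (GroupTower.indTopology S = GroupTower.bsTopology S ∧
      @IsTopologicalGroup G (GroupTower.indTopology S) _) ∧
    (GroupTower.indTopology S = GroupTower.grTopology S ∧
      ∃ H : Subgroup G, IsOpen[GroupTower.indTopology S] (H : Set G) ∧
        @IsKOmegaSpace H ((GroupTower.indTopology S).induced (Subtype.val : H → G))) ∧
    ((∀ n, TopologicalSpace.MetrizableSpace (S n)) →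
      ((∃ m, ∀ n ≥ m, IsOpen ((S n).subgroupOf (S (n + 1)) : Set (S (n + 1)))) →
        @TopologicalSpace.MetrizableSpace G (GroupTower.indTopology S) ∧
        @LocallyCompactSpace G (GroupTower.indTopology S)) ∧
      ((¬ ∃ m, ∀ n ≥ m, IsOpen ((S n).subgroupOf (S (n + 1)) : Set (S (n + 1)))) →
        (∃ H : Subgroup G, IsOpen[GroupTower.indTopology S] (H : Set G) ∧
          @IsMKOmegaSpace H ((GroupTower.indTopology S).induced (Subtype.val : H → G))) ∧
        @SequentialSpace G (GroupTower.indTopology S) ∧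
        ¬ @FrechetUrysohnSpace G (GroupTower.indTopology S))) := by
  have hT := GroupTower.isTowerLimit_indTopology hle hemb hunion
  let _ : TopologicalSpace G := GroupTower.indTopology S
  have := hT.t2Space
  obtain ⟨C, hC⟩ := hT.exists_isExhaustion
  refine ⟨⟨hT.eq_bsTopology, hT.isTopologicalGroup⟩, ⟨hT.eq_grTopology, hC.subgroup,
    hC.isOpen_subgroup hT, hC.isKOmegaSpace_subgroup hT⟩, fun _ => ⟨?_, fun h => ⟨?_, ?_, ?_⟩⟩⟩
  · rintro ⟨m, hm⟩
    exact ⟨hT.metrizableSpace_of_isOpen hm, hT.locallyCompactSpace_of_isOpen hm⟩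
  · exact ⟨hC.subgroup, hC.isOpen_subgroup hT, hC.isMKOmegaSpace_subgroup hT⟩
  · exact hT.sequentialSpace
  · exact hT.not_frechetUrysohnSpace h
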